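/- Let $A$ be a discrete valuation ring with maximal ideal $\mathfrak p$ and field of fractions $K$ of characteristic different from $2$, and let $\overline K$ be an algebraic closure of $K$. Let $g\ge 1$ and let $C: Y^2=f(X)$, $f\in A[X]$, be a hyperelliptic curve of genus $g$ over $K$; that is, $f$ is separable over $K$, of degree $2g+2$ or $2g+1$. Let $\alpha_1,\dots,\alpha_{2g+2}$ be the roots of $f$ in $\overline K\cup\{\infty\}$, where $\infty$ is counted as a root when $\deg f=2g+1$; in the formulas below any difference $\alpha_r-\alpha_s$ in which $\alpha_r=\infty$ or $\alpha_s=\infty$ is replaced by $1$. For a prime $P$ of a commutative ring $R$, an equation $Y^2=h(X)$ of genus $g$ with $h\in R[X]$ has *good reduction* at $P$ if the residue field $k(P)$ has characteristic different from $2$ and the image of $h$ in $k(P)[X]$ is separable of degree $2g+1$ or $2g+2$, so that the reduced equation defines a nonsingular hyperelliptic curve of genus $g$. The curve $C$ has *potentially good reduction* if there are a finite extension $K_1$ of $K$, a valuation ring $A_1$ of $K_1$ whose maximal ideal $\mathfrak p_1$ lies above $\mathfrak p$, and an equation $Y^2=f_1(X)$, $f_1\in A_1[X]$, with good reduction at $\mathfrak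 p_1$, which is a model of $C$ over $K_1$, i.e. is obtained from $Y^2=f(X)$ by a substitution $X\mapsto\frac{aX+b}{cX+d}$, $Y\mapsto\frac{eY}{(cX+d)^{g+1}}$ with $a,b,c,d,e\in K_1$, $ad-bc\ne0$, $e\neq 0$. For $i\ne j$ let $p_{ij}\in\overline K$ be any product of a $4g$-th root of unity and a $2g$-th root of $\prod_{k\ne i,j}\frac{\alpha_j-\alpha_k}{\alpha_i-\alpha_k}$, put $\ell_{ijk}=p_{ij}\frac{\alpha_i-\alpha_k}{\alpha_j-\alpha_k}$ for $k\neq i,j$, and let $$\mathcal M_{ij}:\; Y^2=\mathcal F_{ij}(X)=X\prod_{k\ne i,j}(X-\ell_{ijk})=X^{2g+1}+G_{ij,1}X^{2g}+\dots+G_{ij,2g-1}X^2\pm X$$ be the corresponding symmetric model of $C$, with symmetric coefficients $G_{ij,k}$. Let $A'=A[G_{ij,1},\dots,G_{ij,2g-1}]\subseteq\overline K$. Suppose that $C$ has potentially good reduction. Then: (a) the symmetric coefficients $G_{ij,1},\dots,G_{ij,2g-1}$ are integral over $A$ (that is, integral at every place of $K(G_{ij,1},\dots,G_{ij,2g-1})$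 above $\mathfrak p$); (b) $\mathcal F_{ij}$ has coefficients in $A'$, and the symmetric model $\mathcal M_{ij}$ has good reduction at every prime $\mathfrak p'$ of $A'$ lying above $\mathfrak p$. -/

import Mathlib

namespace SymmetricModel

noncomputable section

open Polynomial

/-- The equation `Y² = f(X)` over the field `L` defines a (nonsingular) hyperelliptic curve of
genus `g`: the characteristic is not `2`, `f` has no multiple root in an algebraic closure, and
`f` has degree `2g+2`, or `2g+1` (then `∞` is a branch point). -/
def IsHyperelliptic {L : Type*} [Field L] (g : ℕ) (f : L[X]) : Prop :=
  (2 : L) ≠ 0 ∧ f.Separable ∧ (f.natDegree = 2 * g + 1 ∨ f.natDegree = 2 * g + 2)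

/-- The equation `Y² = f(X)` of genus `g` with coefficients in `R` has good reduction at the prime
`P`: the reduced equation over the residue field of `P` is again a nonsingular hyperelliptic
equation of genus `g`. -/
def HasGoodReductionAt {R : Type*} [CommRing R] (g : ℕ) (f : R[X]) (P : Ideal R) [P.IsPrime] :
    Prop :=
  IsHyperelliptic g (f.map (algebraMap R P.ResidueField))

/-- `(cX+d)^(2g+2) f((aX+b)/(cX+d))` for `f` of degree at most `2g+2`. -/
def mobiusSubst {L : Type*} [Field L] (g : ℕ) (f : L[X]) (a b c d : L) : L[X] :=
  ∑ n ∈ Finset.range (2 * g + 3),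
    C (f.coeff n) * (C a * X + C b) ^ n * (C c * X + C d) ^ (2 * g + 2 - n)

/-- `Y² = f(X)` and `Y² = f₁(X)` are equations of the same hyperelliptic curve of genus `g` over
`L`: a substitution `X ↦ (aX+b)/(cX+d)`, `Y ↦ eY/(cX+d)^(g+1)` with `ad - bc ≠ 0` and `e ≠ 0`
takes the first to the second. -/
def IsModelOf {L : Type*} [Field L] (g : ℕ) (f₁ f : L[X]) : Prop :=
  ∃ a b c d e : L, a * d - b * c ≠ 0 ∧ e ≠ 0 ∧ mobiusSubst g f a b c d = C (e ^ 2) * f₁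

/-- Potentially good reduction of the hyperelliptic curve `Y² = f(X)` of genus `g` over the
discrete valuation ring `A` with fraction field `K` and algebraic closure `Kbar`: over some finite
extension `K₁` of `K` in `Kbar` there are a valuation ring `A₁` of `K₁` whose maximal ideal lies above
that of `A` (such an `A₁` is automatically discrete), and a model `Y² = f₁(X)` of the curve with
coefficients in `A₁` that has good reduction at the maximal ideal of `A₁`. -/
def HasPotentiallyGoodReduction {A : Type*} [CommRing A] [IsLocalRing A]
    (K : Type*) [Field K] [Algebra A K] (Kbar : Type*) [Field Kbar] [Algebra K Kbar]
    (g : ℕ) (f : A[X]) : Prop :=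
  ∃ (K₁ : IntermediateField K Kbar) (A₁ : ValuationSubring K₁) (f₁ : A₁[X]),
    FiniteDimensional K K₁ ∧
    (∀ x : A, algebraMap K K₁ (algebraMap A K x) ∈ A₁) ∧
    (∀ x ∈ IsLocalRing.maximalIdeal A,
      A₁.valuation (algebraMap K K₁ (algebraMap A K x)) < 1) ∧
    IsModelOf g (f₁.map (algebraMap A₁ K₁)) ((f.map (algebraMap A K)).map (algebraMap K K₁)) ∧
    HasGoodReductionAt g f₁ (IsLocalRing.maximalIdeal A₁)

section Invariants

variable {Kbar : Type*} [Field Kbar]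

/-- The factor `X - x` for a finite point `x` of the projective line, and `1` for `∞`. -/
def linearFactor : OnePoint Kbar → Kbar[X]
  | some x => X - C x
  | none => 1

/-- The points `α 0, …, α (2g+1)` of the projective line are the roots of `f`, where `∞` counts as
a root when `f` has degree `2g+1`: `f` is its leading coefficient times the product of the
`X - α k` over the finite `α k`. -/
def IsRootLabelling (g : ℕ) (f : Kbar[X]) (α : Fin (2 * g + 2) → OnePoint Kbar) : Prop :=
  f = C f.leadingCoeff * ∏ k, linearFactor (α k)

/-- The difference `x - y` of two points of the projective line, with the convention that it is
replaced by `1` as soon as one of the points is `∞`. -/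
def diff : OnePoint Kbar → OnePoint Kbar → Kbar
  | some x, some y => x - y
  | _, _ => 1

/-- `p` is a symmetric ratio of index `(i, j)`: a `2g`-th root of
`∏_{k ≠ i, j} (α_j - α_k) / (α_i - α_k)` times a `4g`-th root of unity. -/
def IsSymmetricRatio (g : ℕ) (α : Fin (2 * g + 2) → OnePoint Kbar) (i j : Fin (2 * g + 2)) (p : Kbar) :
    Prop :=
  ∃ ζ q : Kbar, ζ ^ (4 * g) = 1 ∧
    q ^ (2 * g) = ∏ k ∈ Finset.univ \ {i, j}, diff (α j) (α k) / diff (α i) (α k) ∧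
    p = ζ * q

/-- The symmetric root `ℓ_{ijk} = p (α_i - α_k) / (α_j - α_k)` for the symmetric ratio `p`. -/
def symmetricRoot {g : ℕ} (α : Fin (2 * g + 2) → OnePoint Kbar) (i j : Fin (2 * g + 2)) (p : Kbar)
    (k : Fin (2 * g + 2)) : Kbar :=
  p * (diff (α i) (α k) / diff (α j) (α k))

/-- The right-hand side `X ∏_{k ≠ i, j} (X - ℓ_{ijk})` of the symmetric model. -/
def symmetricPoly {g : ℕ} (α : Fin (2 * g + 2) → OnePoint Kbar) (i j : Fin (2 * g + 2)) (p : Kbar) :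
    Kbar[X] :=
  X * ∏ k ∈ Finset.univ \ {i, j}, (X - C (symmetricRoot α i j p k))

/-- The symmetric coefficient `G_{ij,k}`, the coefficient of `X^(2g+1-k)` in the symmetric model. -/
def symmetricCoeff {g : ℕ} (α : Fin (2 * g + 2) → OnePoint Kbar) (i j : Fin (2 * g + 2)) (p : Kbar)
    (k : ℕ) : Kbar :=
  (symmetricPoly α i j p).coeff (2 * g + 1 - k)

/-- The ring of definition `A[G_{ij,1}, …, G_{ij,2g-1}]` of the symmetric model. -/
def ringOfDefinition (A : Type*) [CommRing A] [Algebra A Kbar] {g : ℕ}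
    (α : Fin (2 * g + 2) → OnePoint Kbar) (i j : Fin (2 * g + 2)) (p : Kbar) : Subalgebra A Kbar :=
  Algebra.adjoin A (symmetricCoeff α i j p '' Set.Icc 1 (2 * g - 1))

end Invariants

end

end SymmetricModel

namespace SymmetricModel

open Polynomial

/-! Good reduction keeps the branch points of a model distinct in the residue field, so their
cross-ratios lie in a valuation ring `B` of `Kbar` dominating `A`
(`crossRatio_mem_valuationSubring`). Cross-ratios do not change under Möbius substitutions, so those
of the `α k` lie in `B` too. Conjugation over `K` permutes the roots, so all conjugates of such a
cross-ratio lie in `B`; its minimal polynomial has coefficients in `B ∩ K = A`, and it is integral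
over `A` (`isIntegral_crossRatio`).

Quotients of two symmetric roots are cross-ratios, and the normalization of `p` makes the product of
all symmetric roots `±1`. Hence each symmetric root is a unit of the integral closure of `A`, and by
a Plücker relation so is each difference of two of them (`isIntegral_symmetricRoot`). So the
symmetric model has good reduction at every prime of the integral closure with residue
characteristic not `2`. Lying over and invariance under residue field extension bring this down to
the ring of definition. -/

theorem natDegree_C_mul_X_sub_C_le {R : Type*} [CommRing R] (a b : R) :
    (C a * X - C b).natDegree ≤ 1 := by
  rw [sub_eq_add_neg, ← C_neg]
  exact natDegree_linear_le

/-! ### Factorizations of separable polynomials over a field -/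

section ResidueField

variable {k : Type*} [Field k] {ι : Type*} [Fintype ι]

/-- The linear forms in a factorization of a separable polynomial of (almost) full degree are
pairwise independent. -/
theorem det_ne_zero_of_separable {h : k[X]} {c : k} {x y : ι → k}
    (hfac : h = C c * ∏ i, (C (y i) * X - C (x i))) (hsep : h.Separable)
    (hdeg : Fintype.card ι ≤ h.natDegree + 1) {i j : ι} (hij : i ≠ j) :
    x i * y j - x j * y i ≠ 0 := by
  classical
  intro hdet
  have h0 : h ≠ 0 := hsep.ne_zero
  have hne : ∀ m, C (y m) * X - C (x m) ≠ 0 := fun m hm =>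
    h0 (by rw [hfac, Finset.prod_eq_zero (Finset.mem_univ m) hm, mul_zero])
  have hy : ∀ m, y m = 0 → x m ≠ 0 := by
    intro m h1 h2
    exact hne m (by simp [h1, h2])
  have hji : j ∈ Finset.univ.erase i := by simp [hij.symm]
  have hsplit : h = (C (y i) * X - C (x i)) * (C (y j) * X - C (x j)) *
      (C c * ∏ m ∈ (Finset.univ.erase i).erase j, (C (y m) * X - C (x m))) := by
    rw [hfac, ← Finset.mul_prod_erase Finset.univ _ (Finset.mem_univ i),
      ← Finset.mul_prod_erase (Finset.univ.erase i) _ hji]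
    ring
  -- Proportional forms are either both constant, costing two degrees where `hdeg` allows one, or
  -- multiples of one form of degree 1, whose square then divides the squarefree `h`.
  by_cases hi : y i = 0
  · have hj : y j = 0 := by
      have : x i * y j = 0 := by rw [hi, mul_zero, sub_zero] at hdet; exact hdet
      exact (mul_eq_zero.mp this).resolve_left (hy i hi)
    have hle : h.natDegree ≤ ((Finset.univ.erase i).erase j).card := by
      rw [hsplit, hi, hj]
      have h1 : (C (0 : k) * X - C (x i)) * (C 0 * X - C (x j)) = C (x i * x j) := by simp
      rw [h1]
      refine (natDegree_C_mul_le _ _).trans ((natDegree_C_mul_le _ _).trans ?_)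
      refine (natDegree_prod_le _ _).trans ?_
      refine (Finset.sum_le_card_nsmul _ _ 1 fun m _ => ?_).trans (by simp)
      exact natDegree_C_mul_X_sub_C_le _ _
    rw [Finset.card_erase_of_mem hji, Finset.card_erase_of_mem (Finset.mem_univ i),
      Finset.card_univ] at hle
    have : 1 < Fintype.card ι := Fintype.one_lt_card_iff.mpr ⟨i, j, hij⟩
    omega
  · have hprop : C (y j) * X - C (x j) = C (y j / y i) * (C (y i) * X - C (x i)) := by
      have h1 : y j / y i * y i = y j := div_mul_cancel₀ _ hi
      have h2 : y j / y i * x i = x j := by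
        field_simp
        linear_combination hdet
      rw [mul_sub, ← mul_assoc, ← C_mul, ← C_mul, h1, h2]
    have hu : IsUnit (C (y i) * X - C (x i)) := by
      refine hsep.squarefree _ ⟨C (y j / y i) *
        (C c * ∏ m ∈ (Finset.univ.erase i).erase j, (C (y m) * X - C (x m))), ?_⟩
      rw [hprop] at hsplit
      rw [hsplit]
      ring
    have hd : (C (y i) * X - C (x i)).natDegree = 1 := by
      rw [sub_eq_add_neg, ← C_neg]
      exact natDegree_linear hi
    rw [natDegree_eq_zero_of_isUnit hu] at hd
    exact zero_ne_one hd

end ResidueField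

/-! ### Cross-ratios over a valuation ring -/

section ValuationRing

variable {L : Type*} [Field L] (B : ValuationSubring L) {ι : Type*} [Fintype ι]

/-- A nonzero vector over a field with a valuation ring `B` has a primitive multiple over `B`. -/
theorem exists_primitive_multiple {x y : L} (hxy : x ≠ 0 ∨ y ≠ 0) :
    ∃ (s : L) (u v : B), s ≠ 0 ∧ s * x = u ∧ s * y = v ∧ (u = 1 ∨ v = 1) := by
  by_cases hx : x = 0
  · have hy : y ≠ 0 := hxy.resolve_left (fun h => h hx)
    exact ⟨y⁻¹, 0, 1, inv_ne_zero hy, by simp [hx], by simp [hy], Or.inr rfl⟩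
  by_cases hy : y = 0
  · exact ⟨x⁻¹, 1, 0, inv_ne_zero hx, by simp [hx], by simp [hy], Or.inl rfl⟩
  rcases B.mem_or_inv_mem (x / y) with h | h
  · exact ⟨y⁻¹, ⟨_, h⟩, 1, inv_ne_zero hy, by simp [div_eq_inv_mul], by simp [hy], Or.inr rfl⟩
  · exact ⟨x⁻¹, 1, ⟨_, h⟩, inv_ne_zero hx, by simp [hx], by simp [div_eq_inv_mul], Or.inl rfl⟩

/-- If a polynomial over a valuation ring has separable reduction of (almost) full degree, then
cross-ratios of its roots are integral. -/
theorem crossRatio_mem_valuationSubring {h : B[X]} {c : L} {x y : ι → L}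
    (hfac : h.map B.subtype = C c * ∏ i, (C (y i) * X - C (x i)))
    (hsep : (h.map (IsLocalRing.residue B)).Separable)
    (hdeg : Fintype.card ι ≤ (h.map (IsLocalRing.residue B)).natDegree + 1)
    {i j k m : ι} (him : i ≠ m) (hjk : j ≠ k) :
    (x i * y k - x k * y i) * (x j * y m - x m * y j) /
      ((x i * y m - x m * y i) * (x j * y k - x k * y j)) ∈ B := by
  have h0 : h.map (IsLocalRing.residue B) ≠ 0 := hsep.ne_zero
  have hh0 : h ≠ 0 := by rintro rfl; simp at h0
  have hinj : Function.Injective B.subtype := Subtype.val_injective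
  have hxy : ∀ i, x i ≠ 0 ∨ y i ≠ 0 := by
    intro i
    by_contra! hi
    apply hh0
    apply Polynomial.map_injective _ hinj
    rw [hfac, Finset.prod_eq_zero (Finset.mem_univ i) (by simp [hi.1, hi.2])]
    simp
  choose s u v hs hu hv huv using fun i => exists_primitive_multiple B (hxy i)
  set q : B[X] := ∏ i, (C (v i) * X - C (u i)) with hq
  have hqmap : q.map B.subtype = C (∏ i, s i) * ∏ i, (C (y i) * X - C (x i)) := by
    rw [hq, Polynomial.map_prod, map_prod, ← Finset.prod_mul_distrib]
    refine Finset.prod_congr rfl fun i _ => ?_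
    have h1 : B.subtype (u i) = s i * x i := (hu i).symm
    have h2 : B.subtype (v i) = s i * y i := (hv i).symm
    simp only [Polynomial.map_sub, Polynomial.map_mul, map_C, map_X, h1, h2, C_mul]
    ring
  have hS : ∏ i, s i ≠ 0 := Finset.prod_ne_zero_iff.mpr fun i _ => hs i
  set c' : L := c / ∏ i, s i with hc'
  have hfac' : h.map B.subtype = C c' * q.map B.subtype := by
    rw [hqmap, hfac, ← mul_assoc, ← C_mul, hc', div_mul_cancel₀ _ hS]
  -- Gauss's lemma: a product of primitive forms is primitive, so some coefficient of `q` is a unit.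
  -- Comparing it with that of `h` puts the constant `c'` in `B`.
  have hqres : q.map (IsLocalRing.residue B) ≠ 0 := by
    rw [hq, Polynomial.map_prod]
    refine Finset.prod_ne_zero_iff.mpr fun i _ hi => ?_
    simp only [Polynomial.map_sub, Polynomial.map_mul, map_C, map_X] at hi
    have e0 := congrArg (fun p => coeff p 0) hi
    have e1 := congrArg (fun p => coeff p 1) hi
    simp at e0 e1
    rcases huv i with h | h
    · simp [h] at e0
    · simp [h] at e1
  obtain ⟨n, hn⟩ : ∃ n, (q.map (IsLocalRing.residue B)).coeff n ≠ 0 := by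
    by_contra! hall
    exact hqres (Polynomial.ext (by simpa using hall))
  rw [coeff_map, IsLocalRing.residue_ne_zero_iff_isUnit] at hn
  have hcB : c' ∈ B := by
    obtain ⟨w, hw⟩ := hn.exists_right_inv
    have e := congrArg (fun p => coeff p n) hfac'
    simp only [coeff_map, coeff_C_mul] at e
    have hw' : B.subtype (q.coeff n) * B.subtype w = 1 := by rw [← map_mul, hw, map_one]
    have : c' = B.subtype (h.coeff n * w) := by
      rw [map_mul, e, mul_assoc, hw', mul_one]
    rw [this]
    exact (h.coeff n * w).2
  have hfacB : h = C (⟨c', hcB⟩ : B) * q := by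
    apply Polynomial.map_injective _ hinj
    rw [hfac', Polynomial.map_mul, map_C]
    rfl
  have hdet : ∀ i j, i ≠ j → IsUnit (u i * v j - u j * v i) := by
    intro i j hij
    rw [← IsLocalRing.residue_ne_zero_iff_isUnit]
    have := det_ne_zero_of_separable (c := IsLocalRing.residue B ⟨c', hcB⟩)
      (x := fun i => IsLocalRing.residue B (u i)) (y := fun i => IsLocalRing.residue B (v i))
      (h := h.map (IsLocalRing.residue B))
      (by rw [hfacB, hq]; simp [Polynomial.map_prod]) hsep hdeg hij
    simpa using this
  obtain ⟨r, hr⟩ := ((hdet i m him).mul (hdet j k hjk)).exists_right_inv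
  have hr' := congrArg B.subtype hr
  -- Each index occurs once in the numerator and once in the denominator, so the scalings `s`
  -- cancel.
  have key : (x i * y k - x k * y i) * (x j * y m - x m * y j) /
      ((x i * y m - x m * y i) * (x j * y k - x k * y j)) =
      B.subtype ((u i * v k - u k * v i) * (u j * v m - u m * v j) * r) := by
    simp only [map_mul, map_sub, map_one, ValuationSubring.subtype_apply, ← hu, ← hv] at hr' ⊢
    have hne : (x i * y m - x m * y i) * (x j * y k - x k * y j) ≠ 0 := by
      intro h
      have : (s i * s m * s j * s k * (r : L)) *
        ((x i * y m - x m * y i) * (x j * y k - x k * y j)) = 1 := by linear_combination hr'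
      rw [h, mul_zero] at this
      exact zero_ne_one this
    rw [div_eq_iff hne]
    linear_combination (-(x i * y k - x k * y i) * (x j * y m - x m * y j)) * hr'
  rw [key]
  exact ((u i * v k - u k * v i) * (u j * v m - u m * v j) * r).2

end ValuationRing

/-! ### Möbius substitution in binary forms -/

section Mobius

variable {L : Type*} [Field L]

/-- Homogenization is multiplicative, which lets the substitution be computed factor by factor. -/
theorem mobiusSubst_eq_aeval_homogenize (g : ℕ) (f : L[X]) (a b c d : L) :
    mobiusSubst g f a b c d =
      MvPolynomial.aeval ![C a * X + C b, C c * X + C d] (f.homogenize (2 * g + 2)) := by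
  rw [mobiusSubst, homogenize, Finset.Nat.sum_antidiagonal_eq_sum_range_succ_mk, map_sum]
  refine Finset.sum_congr rfl fun n _ => ?_
  rw [MvPolynomial.aeval_monomial, Finsupp.update_eq_add_single (by simp),
    Finsupp.prod_add_index' (by simp) (by simp [pow_add])]
  simp [mul_assoc]

theorem mobiusSubst_map {L' : Type*} [Field L'] (φ : L →+* L') (g : ℕ) (f : L[X]) (a b c d : L) :
    (mobiusSubst g f a b c d).map φ = mobiusSubst g (f.map φ) (φ a) (φ b) (φ c) (φ d) := by
  simp [mobiusSubst, Polynomial.map_sum]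

/-- The root `(x : y)` moves by the adjugate matrix, to `(dx - by : ay - cx)`; roots at `∞` need no
special treatment. -/
theorem mobiusSubst_prod_linear {g : ℕ} (l : L) (x y : Fin (2 * g + 2) → L) (a b c d : L) :
    mobiusSubst g (C l * ∏ i, (C (y i) * X - C (x i))) a b c d =
      C l * ∏ i, (C (a * y i - c * x i) * X - C (d * x i - b * y i)) := by
  rw [mobiusSubst_eq_aeval_homogenize, homogenize_C_mul]
  have h := homogenize_finsetProd (s := Finset.univ) (p := fun i => C (y i) * X - C (x i))
    (n := fun _ => 1) (fun i _ => natDegree_C_mul_X_sub_C_le _ _)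
  rw [Finset.sum_const, Finset.card_univ, Fintype.card_fin, smul_eq_mul, mul_one] at h
  rw [h, map_mul, map_prod]
  congr 1
  · simp
  · refine Finset.prod_congr rfl fun i _ => ?_
    simp
    ring

end Mobius

/-! ### Points of the projective line -/

section Coordinates

variable {L : Type*} [Field L]

/-- Homogeneous coordinates of a point of the projective line, normalized so that `linearFactor`
is the linear form vanishing at the point. -/
def coord : OnePoint L → L × L
  | some x => (x, 1)
  | none => (-1, 0)

/-- The determinant of the homogeneous coordinates of two points of the projective line. -/
def det (P Q : OnePoint L) : L :=
  (coord P).1 * (coord Q).2 - (coord Q).1 * (coord P).2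

theorem linearFactor_eq (P : OnePoint L) :
    linearFactor P = C (coord P).2 * X - C (coord P).1 := by
  rcases P with _ | x <;> simp [linearFactor, coord]

/-- For distinct points, `diff` and `det` agree up to a sign depending on the first point only. -/
theorem exists_diff_eq_mul_det (P : OnePoint L) :
    ∃ s : L, s ≠ 0 ∧ ∀ Q, det P Q ≠ 0 → diff P Q = s * det P Q := by
  rcases P with _ | x
  -- From `∞` to a finite point `det` is `-1` but `diff` is `1`. The pair `(∞, ∞)`, where `det`
  -- vanishes and `diff` does not, is excluded.
  · refine ⟨-1, by simp, ?_⟩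
    rintro (_ | y) h <;> simp_all [det, coord, diff]
  · refine ⟨1, one_ne_zero, ?_⟩
    rintro (_ | y) - <;> simp [det, coord, diff]

theorem isRoot_linearFactor_iff {P : OnePoint L} {x : L} :
    (linearFactor P).eval x = 0 ↔ P = some x := by
  rcases P with _ | y
  · simp [linearFactor]
  · simp only [linearFactor, eval_sub, eval_X, eval_C, sub_eq_zero]
    exact ⟨fun h => congrArg some h.symm, fun h => (Option.some.inj h).symm⟩

end Coordinates

/-- Allows good reduction to be tested after any extension of the residue field. -/
theorem isHyperelliptic_map {g : ℕ} {k k' : Type*} [Field k] [Field k'] (φ : k →+* k') {h : k[X]} :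
    IsHyperelliptic g (h.map φ) ↔ IsHyperelliptic g h := by
  have h2 : (2 : k') ≠ 0 ↔ (2 : k) ≠ 0 := by
    rw [← map_ofNat φ 2, _root_.map_ne_zero]
  rw [IsHyperelliptic, IsHyperelliptic, h2, natDegree_map, separable_map]

theorem isHyperelliptic_algebraicClosure {A K Kbar : Type*} [CommRing A] [Field K] [Algebra A K]
    [Field Kbar] [Algebra K Kbar] [Algebra A Kbar] [IsScalarTower A K Kbar] {g : ℕ} {f : A[X]}
    (hf : IsHyperelliptic g (f.map (algebraMap A K))) :
    IsHyperelliptic g (f.map (algebraMap A Kbar)) := by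
  rw [IsScalarTower.algebraMap_eq A K Kbar, ← Polynomial.map_map]
  exact (isHyperelliptic_map _).mpr hf

/-! ### Labelled roots and their conjugates -/

section Labelling

variable {L : Type*} [Field L] {g : ℕ} {f : L[X]} {α : Fin (2 * g + 2) → OnePoint L}

theorem IsRootLabelling.factorization (hα : IsRootLabelling g f α) :
    f = C f.leadingCoeff * ∏ k, (C (coord (α k)).2 * X - C (coord (α k)).1) := by
  conv_lhs => rw [hα]
  simp only [linearFactor_eq]

theorem IsRootLabelling.det_ne_zero (hα : IsRootLabelling g f α) (hf : IsHyperelliptic g f)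
    {i j : Fin (2 * g + 2)} (hij : i ≠ j) : det (α i) (α j) ≠ 0 :=
  det_ne_zero_of_separable hα.factorization hf.2.1
    (by rw [Fintype.card_fin]; rcases hf.2.2 with h | h <;> omega) hij

/-- An automorphism fixing the coefficients of `f` permutes the roots. -/
theorem IsRootLabelling.exists_permutation (hα : IsRootLabelling g f α)
    (hf : IsHyperelliptic g f) (σ : L ≃+* L) (hσ : f.map (σ : L →+* L) = f) :
    ∃ π : Fin (2 * g + 2) → Fin (2 * g + 2), Function.Injective π ∧
      ∀ i j, det (α (π i)) (α (π j)) = σ (det (α i) (α j)) := by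
  have hex : ∀ i, ∃ k, coord (α k) = (σ (coord (α i)).1, σ (coord (α i)).2) := by
    intro i
    rcases hi : α i with _ | x
    -- The coordinates `(-1, 0)` of `∞` are fixed by `σ`.
    · exact ⟨i, by simp [hi, coord]⟩
    · have hx : f.eval x = 0 := by
        rw [hα, eval_mul, eval_prod, Finset.prod_eq_zero (Finset.mem_univ i), mul_zero]
        exact isRoot_linearFactor_iff.mpr hi
      have hσx : f.eval (σ x) = 0 := by
        have := eval_map_apply (f := (σ : L →+* L)) (p := f) x
        rw [hσ, hx, map_zero] at this
        exact this
      rw [hα, eval_mul, eval_prod, eval_C, mul_eq_zero] at hσx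
      obtain ⟨k, -, hk⟩ := Finset.prod_eq_zero_iff.mp
        (hσx.resolve_left (leadingCoeff_ne_zero.mpr hf.2.1.ne_zero))
      exact ⟨k, by rw [isRoot_linearFactor_iff.mp hk]; simp [coord]⟩
  choose π hπ using hex
  have hdet : ∀ i j, det (α (π i)) (α (π j)) = σ (det (α i) (α j)) := by
    intro i j
    simp [det, hπ]
  refine ⟨π, fun i j hij => ?_, hdet⟩
  by_contra hne
  apply hα.det_ne_zero hf hne
  apply σ.injective
  rw [← hdet, hij, map_zero, det]
  ring

end Labelling

/-! ### Passage to a valuation ring of the algebraic closure -/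

section PotentiallyGoodReduction

variable {A K Kbar : Type*} [CommRing A] [IsLocalRing A] [Field K] [Algebra A K]
    [Field Kbar] [Algebra K Kbar] [Algebra A Kbar] [IsScalarTower A K Kbar]
    {g : ℕ} {f : A[X]}

/-- A model with good reduction over a valuation ring of a finite extension yields one over a
valuation ring of the algebraic closure. -/
theorem HasPotentiallyGoodReduction.exists_valuationSubring
    (hpot : HasPotentiallyGoodReduction K Kbar g f) :
    ∃ (B : ValuationSubring Kbar) (h : B[X]),
      (∀ x ∈ IsLocalRing.maximalIdeal A, algebraMap A Kbar x ∈ B.nonunits) ∧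
      IsModelOf g (h.map B.subtype) (f.map (algebraMap A Kbar)) ∧
      IsHyperelliptic g (h.map (IsLocalRing.residue B)) := by
  obtain ⟨K₁, A₁, f₁, -, hA₁, hm, ⟨a, b, c, d, e, had, he, hmod⟩, hgood⟩ := hpot
  -- Chevalley's extension theorem: a valuation ring of `Kbar` dominating `A₁`.
  obtain ⟨B, hφ, hloc⟩ := IsLocalRing.exists_factor_valuationRing
    ((algebraMap K₁ Kbar).comp A₁.subtype)
  let ψ : A₁ →+* B := ((algebraMap K₁ Kbar).comp A₁.subtype).codRestrict B.toSubring hφ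
  have hψloc : IsLocalHom ψ := hloc
  have hψ : B.subtype.comp ψ = (algebraMap K₁ Kbar).comp A₁.subtype := rfl
  refine ⟨B, f₁.map ψ, fun x hx => ?_, ?_, ?_⟩
  · have h1 : (⟨_, hA₁ x⟩ : A₁) ∈ IsLocalRing.maximalIdeal A₁ :=
      (A₁.valuation_lt_one_iff _).mpr (hm x hx)
    have h2 : ψ ⟨_, hA₁ x⟩ ∈ IsLocalRing.maximalIdeal B := by
      rw [IsLocalRing.mem_maximalIdeal, mem_nonunits_iff] at h1 ⊢
      exact fun hu => h1 (isUnit_of_map_unit ψ _ hu)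
    rw [← SetLike.mem_coe, ← ValuationSubring.image_maximalIdeal]
    refine ⟨_, h2, ?_⟩
    change algebraMap K₁ Kbar (algebraMap K K₁ (algebraMap A K x)) = _
    rw [← IsScalarTower.algebraMap_apply K K₁ Kbar, ← IsScalarTower.algebraMap_apply A K Kbar]
  · refine ⟨algebraMap K₁ Kbar a, algebraMap K₁ Kbar b, algebraMap K₁ Kbar c,
      algebraMap K₁ Kbar d, algebraMap K₁ Kbar e, ?_, (_root_.map_ne_zero _).mpr he, ?_⟩
    · rw [← map_mul, ← map_mul, ← map_sub]
      exact (_root_.map_ne_zero _).mpr had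
    · have h1 := congrArg (Polynomial.map (algebraMap K₁ Kbar)) hmod
      rw [mobiusSubst_map, Polynomial.map_mul, map_C, map_pow, Polynomial.map_map,
        Polynomial.map_map, Polynomial.map_map, ← IsScalarTower.algebraMap_eq K K₁ Kbar,
        ← IsScalarTower.algebraMap_eq A K Kbar] at h1
      rw [Polynomial.map_map, hψ]
      exact h1
  · have hker : IsLocalRing.maximalIdeal A₁ ≤ RingHom.ker ((IsLocalRing.residue B).comp ψ) := by
      intro x hx
      rw [RingHom.mem_ker, RingHom.comp_apply, IsLocalRing.residue_eq_zero_iff]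
      rw [IsLocalRing.mem_maximalIdeal, mem_nonunits_iff] at hx ⊢
      exact fun hu => hx (isUnit_of_map_unit ψ _ hu)
    have hunit : (IsLocalRing.maximalIdeal A₁).primeCompl ≤
        (IsUnit.submonoid (IsLocalRing.ResidueField B)).comap
          ((IsLocalRing.residue B).comp ψ) := by
      intro x hx
      have hx' : IsUnit x := by
        by_contra hu
        exact hx ((IsLocalRing.mem_maximalIdeal x).mpr hu)
      exact hx'.map ((IsLocalRing.residue B).comp ψ)
    have hκ : (Ideal.ResidueField.lift _ _ hker hunit).comp (algebraMap A₁ _) =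
        (IsLocalRing.residue B).comp ψ :=
      RingHom.ext fun x => Ideal.ResidueField.lift_algebraMap _ _ hker hunit x
    rw [Polynomial.map_map, ← hκ, ← Polynomial.map_map, isHyperelliptic_map]
    exact hgood

/-- The residue field of `B` has characteristic different from `2`, and the maximal ideal of `A`
maps into that of `B`. -/
theorem two_notMem_maximalIdeal (hpot : HasPotentiallyGoodReduction K Kbar g f) :
    (2 : A) ∉ IsLocalRing.maximalIdeal A := by
  intro h
  obtain ⟨B, h', hB, _, hred⟩ := hpot.exists_valuationSubring
  have h1 := hB 2 h
  rw [← SetLike.mem_coe, ← ValuationSubring.image_maximalIdeal] at h1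
  obtain ⟨b, hb, hb2⟩ := h1
  have hb' : b = 2 := Subtype.ext (hb2.trans (map_ofNat _ 2))
  apply hred.1
  rw [← map_ofNat (IsLocalRing.residue B) 2, IsLocalRing.residue_eq_zero_iff]
  exact hb' ▸ hb

end PotentiallyGoodReduction

/-! ### Integrality of cross-ratios over `A` -/

section Integrality

variable {A K Kbar : Type*} [CommRing A] [IsDomain A] [IsDiscreteValuationRing A]
    [Field K] [Algebra A K] [IsFractionRing A K]
    [Field Kbar] [Algebra K Kbar] [IsAlgClosure K Kbar] [Algebra A Kbar] [IsScalarTower A K Kbar]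

/-- An element all of whose conjugates lie in one valuation ring dominating `A` is integral
over `A`. -/
theorem isIntegral_of_conjugates_mem (B : ValuationSubring Kbar)
    (hB : ∀ x ∈ IsLocalRing.maximalIdeal A, algebraMap A Kbar x ∈ B.nonunits)
    {z : Kbar} (hz : ∀ σ : Kbar ≃ₐ[K] Kbar, σ z ∈ B) : IsIntegral A z := by
  have : IsAlgClosed Kbar := IsAlgClosure.isAlgClosed K
  have : Algebra.IsAlgebraic K Kbar := IsAlgClosure.isAlgebraic
  have hzK : IsIntegral K z := Algebra.IsIntegral.isIntegral z
  -- `B ∩ K = A`: if `x` is not in `A`, then its inverse is a nonunit of `A`, hence of `B`, and `x`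
  -- is not in `B`.
  have hBK : ∀ x : K, algebraMap K Kbar x ∈ B → x ∈ Set.range (algebraMap A K) := by
    intro x hx
    rcases ValuationRing.isInteger_or_isInteger A x with h | ⟨a, ha⟩
    · exact h
    by_cases hx0 : x = 0
    · exact ⟨0, by simp [hx0]⟩
    by_cases hu : IsUnit a
    · obtain ⟨b, hb⟩ := hu.exists_right_inv
      refine ⟨b, ?_⟩
      have := congrArg (algebraMap A K) hb
      rw [map_mul, ha, map_one] at this
      field_simp at this
      exact this
    · exfalso
      have h1 := hB a ((IsLocalRing.mem_maximalIdeal a).mpr hu)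
      rw [IsScalarTower.algebraMap_apply A K Kbar, ha, map_inv₀,
        ValuationSubring.inv_mem_nonunits_iff] at h1
      rcases h1 with h1 | h1
      · exact hx0 (by simpa using h1)
      · exact h1 hx
  have hlift : (minpoly K z).map (algebraMap K Kbar) ∈ lifts B.subtype := by
    rw [(IsAlgClosed.splits ((minpoly K z).map (algebraMap K Kbar))).eq_prod_roots_of_monic
      ((minpoly.monic hzK).map _)]
    refine Subsemiring.multiset_prod_mem _ _ fun q hq => ?_
    obtain ⟨r, hr, rfl⟩ := Multiset.mem_map.mp hq
    have hconj : IsConjRoot K z r := (isConjRoot_iff_mem_minpoly_aroots hzK).mpr hr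
    obtain ⟨σ, hσ⟩ := isConjRoot_iff_exists_algEquiv.mp hconj.symm
    have hrB : r ∈ B := hσ ▸ hz σ
    exact ⟨X - C ⟨r, hrB⟩, by simp⟩
  have hliftA : minpoly K z ∈ lifts (algebraMap A K) := by
    rw [lifts_iff_coeff_lifts] at hlift ⊢
    intro n
    obtain ⟨b, hb⟩ := hlift n
    rw [coeff_map] at hb
    exact hBK _ (hb ▸ b.2)
  obtain ⟨q, hq, -, hmon⟩ := lifts_and_natDegree_eq_and_monic hliftA (minpoly.monic hzK)
  refine ⟨q, hmon, ?_⟩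
  rw [← aeval_def, ← aeval_map_algebraMap K, hq, minpoly.aeval]

variable {g : ℕ} {f : A[X]} {α : Fin (2 * g + 2) → OnePoint Kbar}

/-- Cross-ratios of the roots are integral in the presence of potentially good reduction. -/
theorem isIntegral_crossRatio (hf : IsHyperelliptic g (f.map (algebraMap A K)))
    (hpot : HasPotentiallyGoodReduction K Kbar g f)
    (hα : IsRootLabelling g (f.map (algebraMap A Kbar)) α)
    {i j k m : Fin (2 * g + 2)} (him : i ≠ m) (hjk : j ≠ k) :
    IsIntegral A (det (α i) (α k) * det (α j) (α m) /
      (det (α i) (α m) * det (α j) (α k))) := by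
  obtain ⟨B, h, hB, ⟨a, b, c, d, e, had, he, hmod⟩, hred⟩ := hpot.exists_valuationSubring
  have hf' := isHyperelliptic_algebraicClosure (Kbar := Kbar) hf
  refine isIntegral_of_conjugates_mem (K := K) B hB fun σ => ?_
  obtain ⟨π, hπ, hdet⟩ := hα.exists_permutation hf' σ.toRingEquiv (by
    rw [Polynomial.map_map]
    congr 1
    ext x
    simp [IsScalarTower.algebraMap_apply A K Kbar])
  have hfac : h.map B.subtype = C ((f.map (algebraMap A Kbar)).leadingCoeff / e ^ 2) *
      ∏ n, (C (a * (coord (α n)).2 - c * (coord (α n)).1) * X -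
        C (d * (coord (α n)).1 - b * (coord (α n)).2)) := by
    rw [hα.factorization, mobiusSubst_prod_linear] at hmod
    have h1 : (C ((e ^ 2)⁻¹) : Kbar[X]) * C (e ^ 2) = 1 := by
      rw [← C_mul, inv_mul_cancel₀ (pow_ne_zero 2 he), C_1]
    rw [div_eq_inv_mul, C_mul, mul_assoc, hmod, ← mul_assoc, h1, one_mul]
  have hmem := crossRatio_mem_valuationSubring B hfac hred.2.1
    (by rw [Fintype.card_fin]; rcases hred.2.2 with h | h <;> omega) (hπ.ne him) (hπ.ne hjk)
  have hσ : ∀ r s, σ (det (α r) (α s)) = det (α (π r)) (α (π s)) := fun r s => (hdet r s).symm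
  -- The substitution multiplies every determinant by `ad - bc`, which cancels in the cross-ratio.
  have hD : ∀ r s, (d * (coord (α r)).1 - b * (coord (α r)).2) *
      (a * (coord (α s)).2 - c * (coord (α s)).1) -
      (d * (coord (α s)).1 - b * (coord (α s)).2) *
      (a * (coord (α r)).2 - c * (coord (α r)).1) = (a * d - b * c) * det (α r) (α s) := by
    intro r s
    rw [det]
    ring
  simp only [hD] at hmem
  rw [map_div₀, map_mul, map_mul, hσ, hσ, hσ, hσ]
  convert! hmem using 1
  rw [mul_mul_mul_comm (a * d - b * c), mul_mul_mul_comm (a * d - b * c) (det _ _) (a * d - b * c),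
    mul_div_mul_left _ _ (mul_ne_zero had had)]

end Integrality

/-! ### Symmetric roots and the symmetric polynomial -/

section SymmetricRoots

variable {L : Type*} [Field L] {g : ℕ} {f : L[X]} {α : Fin (2 * g + 2) → OnePoint L}
    {i j : Fin (2 * g + 2)} {p : L}

theorem card_univ_sdiff_pair (hij : i ≠ j) :
    (Finset.univ \ {i, j} : Finset (Fin (2 * g + 2))).card = 2 * g := by
  rw [Finset.card_sdiff_of_subset (Finset.subset_univ _), Finset.card_pair hij]
  simp

theorem ne_of_mem_univ_sdiff_pair {k : Fin (2 * g + 2)}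
    (hk : k ∈ (Finset.univ \ {i, j} : Finset (Fin (2 * g + 2)))) : i ≠ k ∧ j ≠ k := by
  simp only [Finset.mem_sdiff, Finset.mem_univ, Finset.mem_insert, Finset.mem_singleton,
    true_and, not_or] at hk
  exact ⟨Ne.symm hk.1, Ne.symm hk.2⟩

theorem IsRootLabelling.diff_ne_zero (hα : IsRootLabelling g f α) (hf : IsHyperelliptic g f)
    (hij : i ≠ j) : diff (α i) (α j) ≠ 0 := by
  obtain ⟨s, hs, h⟩ := exists_diff_eq_mul_det (α i)
  rw [h _ (hα.det_ne_zero hf hij)]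
  exact mul_ne_zero hs (hα.det_ne_zero hf hij)

theorem IsSymmetricRatio.ne_zero (hp : IsSymmetricRatio g α i j p) (hg : 1 ≤ g)
    (hα : IsRootLabelling g f α) (hf : IsHyperelliptic g f) : p ≠ 0 := by
  obtain ⟨ζ, q, hζ, hq, rfl⟩ := hp
  refine mul_ne_zero ?_ ?_
  · rintro rfl
    rw [zero_pow (by omega)] at hζ
    exact zero_ne_one hζ
  · rintro rfl
    rw [zero_pow (by omega)] at hq
    refine Finset.prod_ne_zero_iff.mpr (fun k hk => ?_) hq.symm
    have hk' := ne_of_mem_univ_sdiff_pair hk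
    exact div_ne_zero (hα.diff_ne_zero hf hk'.2) (hα.diff_ne_zero hf hk'.1)

/-- The product has `2g` factors, and `q ^ (2g)` cancels the quotients of differences, leaving `ζ ^
(2g)`, whose square is `ζ ^ (4g) = 1`. -/
theorem prod_symmetricRoot_sq (hp : IsSymmetricRatio g α i j p)
    (hα : IsRootLabelling g f α) (hf : IsHyperelliptic g f) (hij : i ≠ j) :
    (∏ k ∈ Finset.univ \ {i, j}, symmetricRoot α i j p k) ^ 2 = 1 := by
  obtain ⟨ζ, q, hζ, hq, rfl⟩ := hp
  have h : ∏ k ∈ Finset.univ \ {i, j}, symmetricRoot α i j (ζ * q) k = ζ ^ (2 * g) := by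
    simp only [symmetricRoot]
    rw [Finset.prod_mul_distrib, Finset.prod_const, card_univ_sdiff_pair hij, mul_pow, hq,
      mul_assoc, ← Finset.prod_mul_distrib, Finset.prod_eq_one, mul_one]
    intro k hk
    have hk' := ne_of_mem_univ_sdiff_pair hk
    rw [div_mul_div_cancel₀ (hα.diff_ne_zero hf hk'.1), div_self (hα.diff_ne_zero hf hk'.2)]
  rw [h, ← pow_mul, ← hζ]
  congr 1
  ring

/-- The symmetric roots in terms of determinants of homogeneous coordinates. -/
theorem exists_symmetricRoot_eq (hg : 1 ≤ g) (hp : IsSymmetricRatio g α i j p)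
    (hα : IsRootLabelling g f α) (hf : IsHyperelliptic g f) :
    ∃ p' : L, p' ≠ 0 ∧ ∀ k ∈ Finset.univ \ {i, j},
      symmetricRoot α i j p k = p' * (det (α i) (α k) / det (α j) (α k)) := by
  obtain ⟨s, hs, hs'⟩ := exists_diff_eq_mul_det (α i)
  obtain ⟨t, ht, ht'⟩ := exists_diff_eq_mul_det (α j)
  refine ⟨p * (s / t), mul_ne_zero (hp.ne_zero hg hα hf) (div_ne_zero hs ht), fun k hk => ?_⟩
  have hk' := ne_of_mem_univ_sdiff_pair hk
  rw [symmetricRoot, hs' _ (hα.det_ne_zero hf hk'.1), ht' _ (hα.det_ne_zero hf hk'.2),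
    mul_div_mul_comm, mul_assoc]

theorem symmetricPoly_monic : (symmetricPoly α i j p).Monic :=
  monic_X.mul (monic_prod_of_monic _ _ fun _ _ => monic_X_sub_C _)

theorem symmetricPoly_natDegree (hij : i ≠ j) :
    (symmetricPoly α i j p).natDegree = 2 * g + 1 := by
  rw [symmetricPoly, monic_X.natDegree_mul (monic_prod_of_monic _ _ fun _ _ => monic_X_sub_C _),
    natDegree_X, natDegree_finsetProd_X_sub_C_eq_card, card_univ_sdiff_pair hij, add_comm]

theorem symmetricPoly_coeff_one (hp : IsSymmetricRatio g α i j p)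
    (hα : IsRootLabelling g f α) (hf : IsHyperelliptic g f) (hij : i ≠ j) :
    (symmetricPoly α i j p).coeff 1 = 1 ∨ (symmetricPoly α i j p).coeff 1 = -1 := by
  have h : (symmetricPoly α i j p).coeff 1 =
      ∏ k ∈ Finset.univ \ {i, j}, symmetricRoot α i j p k := by
    rw [symmetricPoly, coeff_X_mul, coeff_zero_prod]
    simp only [coeff_sub, coeff_X_zero, coeff_C_zero, zero_sub]
    rw [Finset.prod_neg, card_univ_sdiff_pair hij, pow_mul, neg_one_sq, one_pow, one_mul]
  rw [h]
  exact sq_eq_one_iff.mp (prod_symmetricRoot_sq hp hα hf hij)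

/-- The symmetric model is defined over the ring generated by its symmetric coefficients. -/
theorem symmetricPoly_mem_lifts {A : Type*} [CommRing A] [Algebra A L]
    (hp : IsSymmetricRatio g α i j p)
    (hα : IsRootLabelling g f α) (hf : IsHyperelliptic g f) (hij : i ≠ j) :
    symmetricPoly α i j p ∈ lifts (algebraMap (ringOfDefinition A α i j p) L) := by
  rw [lifts_iff_coeff_lifts]
  intro n
  suffices h : (symmetricPoly α i j p).coeff n ∈ ringOfDefinition A α i j p from ⟨⟨_, h⟩, rfl⟩
  have hdeg := symmetricPoly_natDegree (α := α) (p := p) hij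
  rcases Nat.lt_or_ge (2 * g + 1) n with hn | hn
  · rw [coeff_eq_zero_of_natDegree_lt (by omega)]
    exact zero_mem _
  rcases Nat.eq_or_lt_of_le hn with rfl | hn
  · have := symmetricPoly_monic (α := α) (i := i) (j := j) (p := p)
    rw [Monic, leadingCoeff, hdeg] at this
    rw [this]
    exact one_mem _
  rcases Nat.lt_or_ge n 2 with h2 | h2
  -- Degrees `0` and `1` are not covered by the generators: these coefficients are `0` and `±1`.
  · interval_cases n
    · rw [symmetricPoly, coeff_X_mul_zero]
      exact zero_mem _
    · rcases symmetricPoly_coeff_one hp hα hf hij with h | h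
      · rw [h]
        exact one_mem _
      · rw [h]
        exact neg_mem (one_mem _)
  · refine Algebra.subset_adjoin ⟨2 * g + 1 - n, ⟨by omega, by omega⟩, ?_⟩
    rw [symmetricCoeff]
    congr 1
    omega

theorem isHyperelliptic_X_mul_prod {ι : Type*} {s : Finset ι} (hs : s.card = 2 * g)
    (h2 : (2 : L) ≠ 0) {r : ι → L} (h0 : ∀ k ∈ s, r k ≠ 0) (hr : Set.InjOn r s) :
    IsHyperelliptic g (X * ∏ k ∈ s, (X - C (r k))) := by
  refine ⟨h2, separable_X.mul (separable_prod_X_sub_C_iff'.mpr hr) ?_, Or.inl ?_⟩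
  · refine IsCoprime.prod_right fun k hk => ?_
    have := isCoprime_X_sub_C_of_isUnit_sub (a := (0 : L)) (b := r k)
      (by simpa using h0 k hk)
    simpa using this
  · rw [monic_X.natDegree_mul (monic_prod_of_monic _ _ fun _ _ => monic_X_sub_C _),
      natDegree_X, natDegree_finsetProd_X_sub_C_eq_card, hs, add_comm]

end SymmetricRoots

/-! ### Units in the integral closure and good reduction there -/

section Main

variable {A K Kbar : Type*} [CommRing A] [IsDomain A] [IsDiscreteValuationRing A]
    [Field K] [Algebra A K] [IsFractionRing A K]
    [Field Kbar] [Algebra K Kbar] [IsAlgClosure K Kbar] [Algebra A Kbar] [IsScalarTower A K Kbar]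
    {g : ℕ} {f : A[X]} {α : Fin (2 * g + 2) → OnePoint Kbar} {i j : Fin (2 * g + 2)} {p : Kbar}

/-- The symmetric roots are units, with unit differences, over the integral closure of `A`. -/
theorem isIntegral_symmetricRoot (hg : 1 ≤ g)
    (hf : IsHyperelliptic g (f.map (algebraMap A K)))
    (hpot : HasPotentiallyGoodReduction K Kbar g f)
    (hα : IsRootLabelling g (f.map (algebraMap A Kbar)) α)
    (hij : i ≠ j) (hp : IsSymmetricRatio g α i j p)
    {k : Fin (2 * g + 2)} (hk : k ∈ Finset.univ \ {i, j}) :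
    symmetricRoot α i j p k ≠ 0 ∧
    IsIntegral A (symmetricRoot α i j p k) ∧ IsIntegral A (symmetricRoot α i j p k)⁻¹ ∧
    ∀ m ∈ Finset.univ \ {i, j}, k ≠ m →
      symmetricRoot α i j p k - symmetricRoot α i j p m ≠ 0 ∧
      IsIntegral A (symmetricRoot α i j p m /
        (symmetricRoot α i j p k - symmetricRoot α i j p m)) := by
  have hf' := isHyperelliptic_algebraicClosure (Kbar := Kbar) hf
  have hdet {r s : Fin (2 * g + 2)} (h : r ≠ s) := hα.det_ne_zero hf' h
  obtain ⟨p', hp', hroot⟩ := exists_symmetricRoot_eq hg hp hα hf'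
  have hne : ∀ m ∈ Finset.univ \ {i, j}, symmetricRoot α i j p m ≠ 0 := by
    intro m hm
    have hm' := ne_of_mem_univ_sdiff_pair hm
    rw [hroot m hm]
    exact mul_ne_zero hp' (div_ne_zero (hdet hm'.1) (hdet hm'.2))
  have hquot : ∀ k ∈ Finset.univ \ {i, j}, ∀ m ∈ Finset.univ \ {i, j},
      IsIntegral A (symmetricRoot α i j p k / symmetricRoot α i j p m) := by
    intro k hk m hm
    have hk' := ne_of_mem_univ_sdiff_pair hk
    have hm' := ne_of_mem_univ_sdiff_pair hm
    convert! isIntegral_crossRatio hf hpot hα hm'.1 hk'.2 using 1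
    have := hdet hk'.1
    have := hdet hk'.2
    have := hdet hm'.1
    have := hdet hm'.2
    rw [hroot k hk, hroot m hm]
    field_simp
  set T := ∏ m ∈ Finset.univ \ {i, j}, symmetricRoot α i j p m with hT
  have hTsq : T ^ 2 = 1 := prod_symmetricRoot_sq hp hα hf' hij
  have hTint : IsIntegral A T := IsIntegral.of_pow two_pos (hTsq ▸ isIntegral_one)
  have hTinv : T⁻¹ = T := inv_eq_of_mul_eq_one_left (by rw [← sq, hTsq])
  have hT0 : T ≠ 0 := Finset.prod_ne_zero_iff.mpr hne
  have hcard := card_univ_sdiff_pair (g := g) hij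
  refine ⟨hne k hk, ?_, ?_, fun m hm hkm => ?_⟩
  · refine IsIntegral.of_pow (n := 2 * g) (by omega) ?_
    -- A `2g`-th power of one root is a product of quotients, all cross-ratios, times `T`, a square
    -- root of `1`.
    have h : symmetricRoot α i j p k ^ (2 * g) =
        (∏ m ∈ Finset.univ \ {i, j}, symmetricRoot α i j p k / symmetricRoot α i j p m) * T := by
      rw [Finset.prod_div_distrib, Finset.prod_const, hcard, ← hT, div_mul_cancel₀ _ hT0]
    rw [h]
    exact (IsIntegral.prod _ fun m hm => hquot k hk m hm).mul hTint
  · refine IsIntegral.of_pow (n := 2 * g) (by omega) ?_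
    have h : (symmetricRoot α i j p k)⁻¹ ^ (2 * g) =
        (∏ m ∈ Finset.univ \ {i, j}, symmetricRoot α i j p m / symmetricRoot α i j p k) * T⁻¹ := by
      rw [Finset.prod_div_distrib, Finset.prod_const, hcard, ← hT, inv_pow, div_mul_eq_mul_div,
        mul_inv_cancel₀ hT0, one_div]
    rw [h, hTinv]
    exact (IsIntegral.prod _ fun m hm => hquot m hm k hk).mul hTint
  · have hk' := ne_of_mem_univ_sdiff_pair hk
    have hm' := ne_of_mem_univ_sdiff_pair hm
    have h1 := hdet hk'.2
    have h2 := hdet hm'.2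
    have h3 := hdet hij
    have h4 := hdet hkm
    have hsub : symmetricRoot α i j p k - symmetricRoot α i j p m =
        p' * (det (α i) (α j) * det (α k) (α m)) / (det (α j) (α k) * det (α j) (α m)) := by
      -- The Plücker relation turns the difference into a product, so that its quotient with a root
      -- is again a cross-ratio up to sign.
      have hpl : det (α i) (α j) * det (α k) (α m) =
          det (α i) (α k) * det (α j) (α m) - det (α i) (α m) * det (α j) (α k) := by
        simp only [det]
        ring
      rw [hroot k hk, hroot m hm, hpl]
      field_simp
    rw [hsub]
    refine ⟨div_ne_zero (mul_ne_zero hp' (mul_ne_zero h3 h4)) (mul_ne_zero h1 h2), ?_⟩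
    convert! (isIntegral_crossRatio hf hpot hα (k := m) (m := j) (i := i) (j := k) hij hkm).neg
      using 1
    have hanti : det (α k) (α j) = - det (α j) (α k) := by
      simp only [det]
      ring
    rw [hroot m hm, hanti]
    field_simp

/-- The symmetric model over the integral closure of `A`, which has good reduction everywhere
above the maximal ideal. -/
theorem exists_symmetricPoly_integralClosure (hg : 1 ≤ g)
    (hf : IsHyperelliptic g (f.map (algebraMap A K)))
    (hpot : HasPotentiallyGoodReduction K Kbar g f)
    (hα : IsRootLabelling g (f.map (algebraMap A Kbar)) α)
    (hij : i ≠ j) (hp : IsSymmetricRatio g α i j p) :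
    ∃ G : (integralClosure A Kbar)[X],
      G.map (algebraMap (integralClosure A Kbar) Kbar) = symmetricPoly α i j p ∧
      ∀ {k : Type _} [Field k] (θ : integralClosure A Kbar →+* k), (2 : k) ≠ 0 →
        IsHyperelliptic g (G.map θ) := by
  have hex : ∀ k, ∃ r : integralClosure A Kbar, k ∈ Finset.univ \ {i, j} →
      (r : Kbar) = symmetricRoot α i j p k := by
    intro k
    by_cases hk : k ∈ Finset.univ \ {i, j}
    · exact ⟨⟨_, (isIntegral_symmetricRoot hg hf hpot hα hij hp hk).2.1⟩, fun _ => rfl⟩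
    · exact ⟨0, fun h => absurd h hk⟩
  choose r hr using hex
  refine ⟨X * ∏ k ∈ Finset.univ \ {i, j}, (X - C (r k)), ?_, fun θ h2 => ?_⟩
  · rw [symmetricPoly, Polynomial.map_mul, map_X, Polynomial.map_prod]
    congr 1
    refine Finset.prod_congr rfl fun k hk => ?_
    rw [Polynomial.map_sub, map_X, map_C, ← hr k hk]
    rfl
  · rw [Polynomial.map_mul, map_X, Polynomial.map_prod]
    simp only [Polynomial.map_sub, map_X, map_C]
    have h0 : ∀ k ∈ Finset.univ \ {i, j}, θ (r k) ≠ 0 := by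
      intro k hk h
      obtain ⟨hne, -, hinv, -⟩ := isIntegral_symmetricRoot hg hf hpot hα hij hp hk
      have h1 : r k * (⟨_, hinv⟩ : integralClosure A Kbar) = 1 :=
        Subtype.ext (by simp [hr k hk, hne])
      have h2 := congrArg θ h1
      rw [map_mul, h, zero_mul, map_one] at h2
      exact zero_ne_one h2
    refine isHyperelliptic_X_mul_prod (card_univ_sdiff_pair hij) h2 h0 fun k hk m hm hkm => ?_
    by_contra hne
    obtain ⟨hsub, hint⟩ := (isIntegral_symmetricRoot hg hf hpot hα hij hp hk).2.2.2 m hm hne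
    -- The difference divides a unit, so `θ` cannot kill it.
    have h1 : (r k - r m) * (⟨_, hint⟩ : integralClosure A Kbar) = r m :=
      Subtype.ext (by
        simp only [MulMemClass.coe_mul, AddSubgroupClass.coe_sub, hr k hk, hr m hm]
        exact mul_div_cancel₀ _ hsub)
    have h2 := congrArg θ h1
    have hkm' : θ (r k) = θ (r m) := hkm
    rw [map_mul, map_sub, hkm', sub_self, zero_mul] at h2
    exact h0 m hm h2.symm

end Main

end SymmetricModel

open SymmetricModel in
theorem mainTheorem4
    {A K Kbar : Type*} [CommRing A] [IsDomain A] [IsDiscreteValuationRing A]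
    [Field K] [Algebra A K] [IsFractionRing A K]
    [Field Kbar] [Algebra K Kbar] [IsAlgClosure K Kbar] [Algebra A Kbar] [IsScalarTower A K Kbar]
    (g : ℕ) (hg : 1 ≤ g) (f : Polynomial A)
    (hf : SymmetricModel.IsHyperelliptic g (f.map (algebraMap A K)))
    (hpot : SymmetricModel.HasPotentiallyGoodReduction K Kbar g f)
    (α : Fin (2 * g + 2) → OnePoint Kbar)
    (hα : SymmetricModel.IsRootLabelling g (f.map (algebraMap A Kbar)) α)
    (i j : Fin (2 * g + 2)) (hij : i ≠ j)
    (p : Kbar) (hp : SymmetricModel.IsSymmetricRatio g α i j p) :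
    (∀ k ∈ Finset.Icc 1 (2 * g - 1),
      IsIntegral A (SymmetricModel.symmetricCoeff α i j p k)) ∧
    ∃ F : Polynomial (SymmetricModel.ringOfDefinition A α i j p),
      F.map (algebraMap (SymmetricModel.ringOfDefinition A α i j p) Kbar) =
        SymmetricModel.symmetricPoly α i j p ∧
      ∀ (P : Ideal (SymmetricModel.ringOfDefinition A α i j p)) [P.IsPrime]
        [P.LiesOver (IsLocalRing.maximalIdeal A)],
        SymmetricModel.HasGoodReductionAt g F P := by
  obtain ⟨G, hG, hGred⟩ := exists_symmetricPoly_integralClosure hg hf hpot hα hij hp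
  have hint : ∀ k, IsIntegral A (symmetricCoeff α i j p k) := by
    intro k
    rw [symmetricCoeff, ← hG, Polynomial.coeff_map]
    exact (G.coeff _).2
  refine ⟨fun k _ => hint k, ?_⟩
  obtain ⟨F, hF⟩ := symmetricPoly_mem_lifts (A := A) hp hα
    (isHyperelliptic_algebraicClosure (Kbar := Kbar) hf) hij
  have hF' : F.map (algebraMap (ringOfDefinition A α i j p) Kbar) = symmetricPoly α i j p := hF
  refine ⟨F, hF', fun P _ _ => ?_⟩
  have hle : ringOfDefinition A α i j p ≤ integralClosure A Kbar := by
    refine Algebra.adjoin_le ?_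
    rintro _ ⟨k, -, rfl⟩
    exact hint k
  let φ : ringOfDefinition A α i j p →+* integralClosure A Kbar :=
    (Subalgebra.inclusion hle).toRingHom
  have hFG : F.map φ = G := by
    apply Polynomial.map_injective (algebraMap (integralClosure A Kbar) Kbar)
      Subtype.val_injective
    rw [Polynomial.map_map, hG, ← hF']
    rfl
  -- Lying over for the integral extension `φ`; reduction at `P` is then tested in the larger
  -- residue field of `Q`.
  obtain ⟨Q, hQ, hQP⟩ : ∃ Q : Ideal (integralClosure A Kbar), Q.IsPrime ∧ Q.comap φ = P := by
    let _ : Algebra (ringOfDefinition A α i j p) (integralClosure A Kbar) := φ.toAlgebra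
    have : IsScalarTower A (ringOfDefinition A α i j p) (integralClosure A Kbar) :=
      IsScalarTower.of_algebraMap_eq fun _ => rfl
    have : Algebra.IsIntegral (ringOfDefinition A α i j p) (integralClosure A Kbar) :=
      Algebra.IsIntegral.tower_top A
    obtain ⟨Q, -, hQ, hQP⟩ := Ideal.exists_ideal_over_prime_of_isIntegral P
      (⊥ : Ideal (integralClosure A Kbar)) (by
        rw [← RingHom.ker_eq_comap_bot, (RingHom.injective_iff_ker_eq_bot (algebraMap
          (ringOfDefinition A α i j p) (integralClosure A Kbar))).mp
          (Subalgebra.inclusion_injective hle)]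
        exact bot_le)
    exact ⟨Q, hQ, hQP⟩
  have hκ : (Ideal.ResidueField.map P Q φ hQP.symm).comp (algebraMap _ P.ResidueField) =
      (algebraMap _ Q.ResidueField).comp φ :=
    RingHom.ext fun x => Ideal.ResidueField.map_algebraMap P Q φ hQP.symm x
  rw [HasGoodReductionAt, ← isHyperelliptic_map (Ideal.ResidueField.map P Q φ hQP.symm),
    Polynomial.map_map, hκ, ← Polynomial.map_map, hFG]
  refine hGred _ fun h2 => two_notMem_maximalIdeal hpot ?_
  rw [Ideal.mem_of_liesOver P (IsLocalRing.maximalIdeal A), map_ofNat, ← hQP, Ideal.mem_comap,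
    ← Ideal.algebraMap_residueField_eq_zero, map_ofNat, map_ofNat, h2]
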